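/- Let $\mathbb{F}$ be an arbitrary field and let $L$ be a solvable left Leibniz algebra over $\mathbb{F}$ (of arbitrary dimension), i.e. a vector space with a bilinear product satisfying $x(yz)=(xy)z+y(xz)$ whose derived series ($L^{(0)}=L$, $L^{(n+1)}=\langle xy\mid x,y\in L^{(n)}\rangle_{\mathbb{F}}$) reaches $0$. Let $A$ be a finite-dimensional minimal (two-sided, nonzero) ideal of $L$ whose right centralizer $C^r_L(A)=\{x\in L\mid ax=0 \text{ for all } a\in A\}$ equals $A$. Then: (1) Every extension of $A$ by $L/A$ inducing the natural actions of $L/A$ on $A$ splits. That is, let $0\to A\xrightarrow{\iota}E\xrightarrow{p}L/A\to 0$ be a short exact sequence of left Leibniz algebras such that $e\,\iota(a)=\iota(xa)$ and $\iota(a)\,e=\iota(ax)$ whenever $a\in A$, $e\in E$, $x\in L$ and $p(e)=x+A$. Then there is a homomorphism of Leibniz algebras $s:L/A\to E$ with $p\circ s=\mathrm{id}_{L/A}$. (2) All complements of $A$ in $L$ are conjugate. That is, if $K$ and $K'$ are subalgebras of $L$ with $L=A\oplus K=A\oplus K'$ as vector spaces, then there is an element $a\in A$ such that $L_a^2=0$,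 where $L_a(x)=ax$, the map $\exp(L_a)=\mathrm{id}_L+L_a$ is an automorphism of the algebra $L$, and $(\mathrm{id}_L+L_a)(K)=K'$. -/

import Mathlib

namespace LeibnizAlg

/-- A (not necessarily associative, not necessarily unital) algebra over `F` is a
`NonUnitalNonAssocRing` with an `F`-module structure for which the product is bilinear
(`IsScalarTower F L L` and `SMulCommClass F L L`). It is a left Leibniz algebra if
every left multiplication operator is a derivation. -/
class IsLeftLeibniz (L : Type*) [NonUnitalNonAssocRing L] : Prop where
  leibniz : ∀ x y z : L, x * (y * z) = (x * y) * z + y * (x * z)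

section Algebra

variable (F : Type*) [Field F] (L : Type*) [NonUnitalNonAssocRing L] [Module F L]

/-- The derived series: `L⁽⁰⁾ = L`, and `L⁽ⁿ⁺¹⁾` is the subspace spanned by the products
of two elements of `L⁽ⁿ⁾`. -/
def derivedSeries : ℕ → Submodule F L
  | 0 => ⊤
  | n + 1 => Submodule.span F
      {z : L | ∃ x ∈ derivedSeries n, ∃ y ∈ derivedSeries n, z = x * y}

/-- An algebra is solvable if its derived series reaches zero. -/
def Solvable : Prop := ∃ n : ℕ, derivedSeries F L n = ⊥

/-- Two-sided ideals: subspaces stable under left and right multiplication by the algebra. -/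
structure AlgIdeal extends Submodule F L where
  mul_mem_left' : ∀ x a : L, a ∈ carrier → x * a ∈ carrier
  mul_mem_right' : ∀ a x : L, a ∈ carrier → a * x ∈ carrier

end Algebra

/-- The right centralizer of a subset `S`: all `x` with `s x = 0` for every `s ∈ S`. -/
def rightCentralizer {L : Type*} [NonUnitalNonAssocRing L] (S : Set L) : Set L :=
  {x : L | ∀ s ∈ S, s * x = 0}

namespace AlgIdeal

variable {F : Type*} [Field F] {L : Type*} [NonUnitalNonAssocRing L] [Module F L]

/-- A minimal ideal: a nonzero ideal such that every ideal contained in it is zero or all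
of it. -/
def IsMinimal (A : AlgIdeal F L) : Prop :=
  A.toSubmodule ≠ ⊥ ∧
    ∀ J : AlgIdeal F L, J.toSubmodule ≤ A.toSubmodule →
      J.toSubmodule = ⊥ ∨ J.toSubmodule = A.toSubmodule

/-- An ideal, regarded as a subalgebra (hence as an algebra in its own right). -/
def toSubalgebra (A : AlgIdeal F L) : NonUnitalSubalgebra F L :=
  { A.toSubmodule with
    mul_mem' := fun {a b} _ hb => A.mul_mem_left' a b hb }

/-- The underlying space of the factor algebra `L / A`. -/
def Quotient (A : AlgIdeal F L) : Type _ := L ⧸ A.toSubmodule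

instance (A : AlgIdeal F L) : AddCommGroup A.Quotient :=
  inferInstanceAs (AddCommGroup (L ⧸ A.toSubmodule))

instance (A : AlgIdeal F L) : Module F A.Quotient :=
  inferInstanceAs (Module F (L ⧸ A.toSubmodule))

/-- The class `x + A` of an element `x` of `L`. -/
def mkQ (A : AlgIdeal F L) : L →ₗ[F] A.Quotient := A.toSubmodule.mkQ

theorem mkQ_surjective (A : AlgIdeal F L) : Function.Surjective A.mkQ :=
  Submodule.mkQ_surjective _

theorem mkQ_eq_iff (A : AlgIdeal F L) (x y : L) :
    A.mkQ x = A.mkQ y ↔ x - y ∈ A.toSubmodule :=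
  Submodule.Quotient.eq _

/-- The product on `L / A`: `(x + A) (y + A) = x y + A`. -/
instance (A : AlgIdeal F L) : Mul A.Quotient where
  mul := Quotient.map₂ (· * ·) (by
    intro x x' hx y y' hy
    have hx' : x - x' ∈ A.toSubmodule := (Submodule.quotientRel_def _).1 hx
    have hy' : y - y' ∈ A.toSubmodule := (Submodule.quotientRel_def _).1 hy
    refine (Submodule.quotientRel_def _).2 ?_
    have h : x * y - x' * y' = (x - x') * y + x' * (y - y') := by
      rw [sub_mul, mul_sub]; abel
    change x * y - x' * y' ∈ A.toSubmodule
    rw [h]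
    exact A.toSubmodule.add_mem (A.mul_mem_right' _ _ hx') (A.mul_mem_left' _ _ hy'))

theorem mkQ_mul (A : AlgIdeal F L) (x y : L) : A.mkQ (x * y) = A.mkQ x * A.mkQ y := rfl

instance (A : AlgIdeal F L) : NonUnitalNonAssocRing A.Quotient where
  left_distrib := by
    intro a b c
    obtain ⟨x, rfl⟩ := A.mkQ_surjective a
    obtain ⟨y, rfl⟩ := A.mkQ_surjective b
    obtain ⟨z, rfl⟩ := A.mkQ_surjective c
    rw [← map_add, ← mkQ_mul, ← mkQ_mul, ← mkQ_mul, ← map_add, mul_add]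
  right_distrib := by
    intro a b c
    obtain ⟨x, rfl⟩ := A.mkQ_surjective a
    obtain ⟨y, rfl⟩ := A.mkQ_surjective b
    obtain ⟨z, rfl⟩ := A.mkQ_surjective c
    rw [← map_add, ← mkQ_mul, ← mkQ_mul, ← mkQ_mul, ← map_add, add_mul]
  zero_mul := by
    intro a
    obtain ⟨x, rfl⟩ := A.mkQ_surjective a
    rw [← map_zero A.mkQ, ← mkQ_mul, zero_mul]
  mul_zero := by
    intro a
    obtain ⟨x, rfl⟩ := A.mkQ_surjective a
    rw [← map_zero A.mkQ, ← mkQ_mul, mul_zero]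

instance [IsScalarTower F L L] (A : AlgIdeal F L) :
    IsScalarTower F A.Quotient A.Quotient where
  smul_assoc := by
    intro c a b
    obtain ⟨x, rfl⟩ := A.mkQ_surjective a
    obtain ⟨y, rfl⟩ := A.mkQ_surjective b
    rw [smul_eq_mul, smul_eq_mul, ← map_smul, ← mkQ_mul, ← mkQ_mul, ← map_smul, smul_mul_assoc]

instance [SMulCommClass F L L] (A : AlgIdeal F L) :
    SMulCommClass F A.Quotient A.Quotient where
  smul_comm := by
    intro c a b
    obtain ⟨x, rfl⟩ := A.mkQ_surjective a
    obtain ⟨y, rfl⟩ := A.mkQ_surjective b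
    rw [smul_eq_mul, smul_eq_mul, ← map_smul, ← mkQ_mul, ← mkQ_mul, ← map_smul, mul_smul_comm]

instance [IsLeftLeibniz L] (A : AlgIdeal F L) : IsLeftLeibniz A.Quotient where
  leibniz := by
    intro a b c
    obtain ⟨x, rfl⟩ := A.mkQ_surjective a
    obtain ⟨y, rfl⟩ := A.mkQ_surjective b
    obtain ⟨z, rfl⟩ := A.mkQ_surjective c
    simp only [← mkQ_mul, ← map_add]
    rw [IsLeftLeibniz.leibniz]

/-- A complement of the ideal `A`: a subalgebra `K` with `L = A ⊕ K` as vector spaces. -/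
def IsComplement (A : AlgIdeal F L) (K : NonUnitalSubalgebra F L) : Prop :=
  IsCompl A.toSubmodule K.toSubmodule

end AlgIdeal

/-- An extension of the algebra `N` by the algebra `Q` with middle term `E`: a short exact
sequence `0 → N → E → Q → 0` of algebra homomorphisms. -/
structure Extension (F : Type*) [Field F] (N E Q : Type*)
    [NonUnitalNonAssocRing N] [Module F N] [NonUnitalNonAssocRing E] [Module F E]
    [NonUnitalNonAssocRing Q] [Module F Q] where
  incl : N →ₙₐ[F] E
  proj : E →ₙₐ[F] Q
  incl_injective : Function.Injective incl
  proj_surjective : Function.Surjective proj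
  exact : ∀ e : E, proj e = 0 ↔ ∃ n : N, incl n = e

namespace Extension

variable {F : Type*} [Field F]

/-- An extension splits if its projection has a section that is an algebra homomorphism. -/
def Splits {N E Q : Type*}
    [NonUnitalNonAssocRing N] [Module F N] [NonUnitalNonAssocRing E] [Module F E]
    [NonUnitalNonAssocRing Q] [Module F Q] (X : Extension F N E Q) : Prop :=
  ∃ s : Q →ₙₐ[F] E, ∀ q : Q, X.proj (s q) = q

/-- The extension `0 → A → E → L / A → 0` induces on `A` the actions of `L / A` that come
from left and right multiplication in `L`: if `e ∈ E` lies over the class of `x ∈ L`, then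
multiplying elements of `A` by `e` (inside `E`) is the same as multiplying them by `x`
(inside `L`). -/
def InducesNaturalActions {L E : Type*} [NonUnitalNonAssocRing L] [Module F L]
    [NonUnitalNonAssocRing E] [Module F E] {A : AlgIdeal F L}
    (X : Extension F A.toSubalgebra E A.Quotient) : Prop :=
  ∀ (e : E) (x : L), X.proj e = A.mkQ x →
    ∀ a : A.toSubalgebra,
      e * X.incl a = X.incl ⟨x * (a : L), A.mul_mem_left' x a a.2⟩ ∧
        X.incl a * e = X.incl ⟨(a : L) * x, A.mul_mem_right' a x a.2⟩

end Extension

end LeibnizAlg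

/-! Everything rests on one element `b` with `b * (b * L)` inside `A` and left multiplication `L_b`
injective, hence bijective, on `A` (`IsMinimal.exists_injective_mulLeft`, for `A ≠ L`). Complements
of `A` are then kernels of squares: in an extension, if `e` lifts `b`, then `ker (L_e ^ 2)` is a
subalgebra mapped bijectively onto `L / A`. In `L`, a complement `K` contains some `k ≡ b` mod `A`
and equals `ker (L_k ^ 2)`; solving `b * a = k - k'` gives the conjugating `a`.

To find `b`, take the last derived term `I` not inside `A`. Minimality makes the action on `A`
symmetric. If every element of `I` killed a nonzero vector of `A`, each would act nilpotently on
`A`; since they commute there, they would have a common null vector. By minimality `I` would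
annihilate `A`, so `I` would lie in the right centralizer, which is `A`. -/

namespace LeibnizAlg

/-! ### Terms of the derived series as ideals. -/

section DerivedSeries

variable {F : Type*} [Field F] {L : Type*} [NonUnitalNonAssocRing L] [Module F L]

theorem mul_mem_derivedSeries_succ {n : ℕ} {x y : L} (hx : x ∈ derivedSeries F L n)
    (hy : y ∈ derivedSeries F L n) : x * y ∈ derivedSeries F L (n + 1) :=
  Submodule.subset_span ⟨x, hx, y, hy, rfl⟩

theorem mul_mem_derivedSeries_left [SMulCommClass F L L] [IsLeftLeibniz L]
    (n : ℕ) (g : L) {x : L} (hx : x ∈ derivedSeries F L n) :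
    g * x ∈ derivedSeries F L n := by
  induction n generalizing x with
  | zero => exact Submodule.mem_top
  | succ n ih =>
    suffices h : derivedSeries F L (n + 1) ≤
        (derivedSeries F L (n + 1)).comap (LinearMap.mulLeft F g) from h hx
    refine Submodule.span_le.2 ?_
    rintro _ ⟨u, hu, v, hv, rfl⟩
    change g * (u * v) ∈ derivedSeries F L (n + 1)
    rw [IsLeftLeibniz.leibniz]
    exact add_mem (mul_mem_derivedSeries_succ (ih hu) hv) (mul_mem_derivedSeries_succ hu (ih hv))

/-- Rests on `(u * v) * g = u * (v * g) - v * (u * g)`. It gives `b * x ∈ I`, hence `b * (b * x) ∈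
A`, for `b` in the chosen derived term `I`. -/
theorem mul_mem_derivedSeries_right [IsScalarTower F L L] [IsLeftLeibniz L]
    (n : ℕ) (g : L) {x : L} (hx : x ∈ derivedSeries F L n) :
    x * g ∈ derivedSeries F L n := by
  induction n generalizing x with
  | zero => exact Submodule.mem_top
  | succ n ih =>
    suffices h : derivedSeries F L (n + 1) ≤
        (derivedSeries F L (n + 1)).comap (LinearMap.mulRight F g) from h hx
    refine Submodule.span_le.2 ?_
    rintro _ ⟨u, hu, v, hv, rfl⟩
    change u * v * g ∈ derivedSeries F L (n + 1)
    rw [eq_sub_of_add_eq (IsLeftLeibniz.leibniz u v g).symm]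
    exact sub_mem (mul_mem_derivedSeries_succ hu (ih hv)) (mul_mem_derivedSeries_succ hv (ih hu))

/-- In a solvable algebra, a proper subspace contains a term of the derived series whose
predecessor it does not contain. -/
theorem Solvable.exists_derivedSeries_succ_le (hL : Solvable F L) {A : Submodule F L}
    (hA : A ≠ ⊤) : ∃ n, ¬ derivedSeries F L n ≤ A ∧ derivedSeries F L (n + 1) ≤ A := by
  by_contra! h
  have key : ∀ n, ¬ derivedSeries F L n ≤ A := by
    intro n
    induction n with
    | zero => exact fun h0 => hA (top_le_iff.1 h0)
    | succ n ih => exact h n ih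
  obtain ⟨n, hn⟩ := hL
  exact key n (hn ▸ bot_le)

end DerivedSeries

/-- If `e * (e * E)` lies in a subspace on which left multiplication by `e` is injective,
then the elements annihilated by the square of left multiplication by `e` are closed under
products. -/
theorem mul_mul_mul_eq_zero {E : Type*} [NonUnitalNonAssocRing E] [IsLeftLeibniz E]
    {S : Set E} {e : E} (hS : ∀ x, e * (e * x) ∈ S) (hinj : ∀ a ∈ S, e * a = 0 → a = 0)
    {x y : E} (hx : e * (e * x) = 0) (hy : e * (e * y) = 0) : e * (e * (x * y)) = 0 := by
  -- The square of the derivation leaves `2 (e * x) * (e * y)`; in the cube every Leibniz term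
  -- contains `e * (e * x)` or `e * (e * y)`.
  refine hinj _ (hS _) ?_
  rw [IsLeftLeibniz.leibniz e x y, mul_add, IsLeftLeibniz.leibniz e (e * x) y,
    IsLeftLeibniz.leibniz e x (e * y), hx, hy, zero_mul, mul_zero, zero_add, add_zero, mul_add,
    IsLeftLeibniz.leibniz e (e * x) (e * y), hx, hy, zero_mul, mul_zero, add_zero, add_zero]

/-! ### An element acting injectively on a minimal ideal. -/

namespace AlgIdeal

variable {F : Type*} [Field F] {L : Type*} [NonUnitalNonAssocRing L] [Module F L]
  {A : AlgIdeal F L}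

variable (A) in
/-- The ideal spanned by the symmetrized products of elements of `L` and of `A`. -/
def symmetrizer [IsScalarTower F L L] [SMulCommClass F L L] [IsLeftLeibniz L] : AlgIdeal F L where
  toSubmodule := Submodule.span F {z | ∃ x : L, ∃ a ∈ A.toSubmodule, z = x * a + a * x}
  mul_mem_left' := by
    intro y z hz
    suffices h : Submodule.span F {z | ∃ x : L, ∃ a ∈ A.toSubmodule, z = x * a + a * x} ≤
        (Submodule.span F {z | ∃ x : L, ∃ a ∈ A.toSubmodule, z = x * a + a * x}).comap
          (LinearMap.mulLeft F y) from h hz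
    refine Submodule.span_le.2 ?_
    rintro _ ⟨x, a, ha, rfl⟩
    have h : y * (x * a + a * x) = ((y * x) * a + a * (y * x)) + (x * (y * a) + (y * a) * x) := by
      rw [mul_add, IsLeftLeibniz.leibniz y x a, IsLeftLeibniz.leibniz y a x]; abel
    change y * (x * a + a * x) ∈ Submodule.span F {z | ∃ x : L, ∃ a ∈ A.toSubmodule, z = x * a + a * x}
    rw [h]
    exact add_mem (Submodule.subset_span ⟨_, a, ha, rfl⟩)
      (Submodule.subset_span ⟨x, y * a, A.mul_mem_left' y a ha, rfl⟩)
  mul_mem_right' := by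
    intro z y hz
    suffices h : Submodule.span F {z | ∃ x : L, ∃ a ∈ A.toSubmodule, z = x * a + a * x} ≤
        (Submodule.span F {z | ∃ x : L, ∃ a ∈ A.toSubmodule, z = x * a + a * x}).comap
          (LinearMap.mulRight F y) from h hz
    refine Submodule.span_le.2 ?_
    rintro _ ⟨x, a, ha, rfl⟩
    have h : (x * a + a * x) * y = 0 := by
      rw [add_mul, eq_sub_of_add_eq (IsLeftLeibniz.leibniz x a y).symm,
        eq_sub_of_add_eq (IsLeftLeibniz.leibniz a x y).symm]; abel
    change (x * a + a * x) * y ∈ Submodule.span F {z | ∃ x : L, ∃ a ∈ A.toSubmodule, z = x * a + a * x}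
    rw [h]
    exact zero_mem _

/-- Both `L_{x * a}` and `-L_{a * x}` are the commutator of `L_x` and `L_a`. -/
theorem symmetrizer_mul [IsScalarTower F L L] [SMulCommClass F L L] [IsLeftLeibniz L]
    {z : L} (hz : z ∈ (symmetrizer A).toSubmodule) (y : L) : z * y = 0 := by
  suffices h : (symmetrizer A).toSubmodule ≤ LinearMap.ker (LinearMap.mulRight F y) from h hz
  refine Submodule.span_le.2 ?_
  rintro _ ⟨x, a, ha, rfl⟩
  change (x * a + a * x) * y = 0
  rw [add_mul, eq_sub_of_add_eq (IsLeftLeibniz.leibniz x a y).symm,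
    eq_sub_of_add_eq (IsLeftLeibniz.leibniz a x y).symm]
  abel

theorem symmetrizer_le [IsScalarTower F L L] [SMulCommClass F L L] [IsLeftLeibniz L]
    : (symmetrizer A).toSubmodule ≤ A.toSubmodule := by
  refine Submodule.span_le.2 ?_
  rintro _ ⟨x, a, ha, rfl⟩
  exact add_mem (A.mul_mem_left' x a ha) (A.mul_mem_right' a x ha)

/-- `L` acts symmetrically on a proper minimal ideal which contains its right centralizer. -/
theorem IsMinimal.mul_eq_neg_mul [IsScalarTower F L L] [SMulCommClass F L L] [IsLeftLeibniz L]
    (hmin : A.IsMinimal)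
    (hcent : rightCentralizer (A.toSubmodule : Set L) ⊆ A.toSubmodule)
    (hA : A.toSubmodule ≠ ⊤) {a : L} (ha : a ∈ A.toSubmodule) (x : L) : a * x = -(x * a) := by
  rcases hmin.2 _ symmetrizer_le with h | h
  · have : x * a + a * x ∈ (symmetrizer A).toSubmodule := Submodule.subset_span ⟨x, a, ha, rfl⟩
    rw [h, Submodule.mem_bot] at this
    exact eq_neg_of_add_eq_zero_right this
  -- If the symmetrizer is all of `A`, then `A * L = 0`, so `L` is the right centralizer of `A`.
  · exact absurd (eq_top_iff.2 fun y _ => hcent fun c hc => symmetrizer_mul (h ▸ hc) y) hA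

/-- A minimal ideal on which `L` acts symmetrically has no proper nonzero subspaces stable
under left multiplication. -/
theorem IsMinimal.eq_of_mul_mem (hmin : A.IsMinimal)
    (hsymm : ∀ a ∈ A.toSubmodule, ∀ x : L, a * x = -(x * a))
    {W : Submodule F L} (hWA : W ≤ A.toSubmodule) (hW : ∀ (x : L), ∀ w ∈ W, x * w ∈ W)
    (hW0 : W ≠ ⊥) : W = A.toSubmodule :=
  (hmin.2 { W with
    mul_mem_left' := fun x w hw => hW x w hw
    mul_mem_right' := fun w x hw => by
      rw [hsymm w (hWA hw)]
      exact W.neg_mem (hW x w hw) } hWA).resolve_left hW0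

/-- `L_b` and `L_c` commute on `A`, since their commutator is `L_{b * c}` and `A * A = 0`. -/
theorem pow_mulLeft_mul_eq_zero [SMulCommClass F L L] [IsLeftLeibniz L]
    (hAA : ∀ a ∈ A.toSubmodule, ∀ a' ∈ A.toSubmodule, a * a' = 0)
    {b c : L} (hbc : b * c ∈ A.toSubmodule) (k : ℕ) {a : L} (ha : a ∈ A.toSubmodule)
    (h : (LinearMap.mulLeft F b ^ k) a = 0) : (LinearMap.mulLeft F b ^ k) (c * a) = 0 := by
  induction k generalizing a with
  | zero => simpa using congrArg (c * ·) h
  | succ k ih =>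
    rw [pow_succ, Module.End.mul_apply, LinearMap.mulLeft_apply] at h ⊢
    rw [IsLeftLeibniz.leibniz, hAA _ hbc _ ha, zero_add]
    exact ih (A.mul_mem_left' b a ha) h

/-- On `A` the commutator of `L_b` and `L_g` is `L_{b * g}`, which commutes with `L_b` because `b *
(b * g) ∈ A`. Hence one extra power of `L_b` suffices. -/
theorem pow_mulLeft_succ_mul_eq_zero [SMulCommClass F L L] [IsLeftLeibniz L]
    (hAA : ∀ a ∈ A.toSubmodule, ∀ a' ∈ A.toSubmodule, a * a' = 0)
    {b : L} (hb : ∀ x, b * (b * x) ∈ A.toSubmodule) (g : L) (k : ℕ) {a : L}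
    (ha : a ∈ A.toSubmodule) (h : (LinearMap.mulLeft F b ^ k) a = 0) :
    (LinearMap.mulLeft F b ^ (k + 1)) (g * a) = 0 := by
  induction k generalizing a with
  | zero =>
    have : a = 0 := h
    simp [this]
  | succ k ih =>
    have h1 := pow_mulLeft_mul_eq_zero hAA (hb g) (k + 1) ha h
    rw [pow_succ, Module.End.mul_apply, LinearMap.mulLeft_apply, IsLeftLeibniz.leibniz, map_add,
      h1, zero_add]
    refine ih (A.mul_mem_left' b a ha) ?_
    rwa [pow_succ, Module.End.mul_apply] at h

/-- An element `b` whose left multiplication squares into `A` acts either injectively or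
nilpotently on `A`. -/
theorem IsMinimal.exists_pow_mulLeft_eq_zero [SMulCommClass F L L] [IsLeftLeibniz L]
    (hmin : A.IsMinimal)
    (hsymm : ∀ a ∈ A.toSubmodule, ∀ x : L, a * x = -(x * a))
    (hAA : ∀ a ∈ A.toSubmodule, ∀ a' ∈ A.toSubmodule, a * a' = 0)
    {b : L} (hb : ∀ x, b * (b * x) ∈ A.toSubmodule)
    {a : L} (ha : a ∈ A.toSubmodule) (ha0 : a ≠ 0) (hba : b * a = 0)
    {c : L} (hc : c ∈ A.toSubmodule) : ∃ k, (LinearMap.mulLeft F b ^ k) c = 0 := by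
  have key : A.toSubmodule ⊓ Module.End.maxGenEigenspace (LinearMap.mulLeft F b) 0 = A.toSubmodule := by
    refine hmin.eq_of_mul_mem hsymm inf_le_left ?_ ?_
    · rintro x w ⟨hw, hk⟩
      obtain ⟨k, hk⟩ := (Module.End.mem_maxGenEigenspace _ _ _).1 hk
      rw [zero_smul, sub_zero] at hk
      refine ⟨A.mul_mem_left' x w hw, (Module.End.mem_maxGenEigenspace _ _ _).2 ⟨k + 1, ?_⟩⟩
      rw [zero_smul, sub_zero]
      exact pow_mulLeft_succ_mul_eq_zero hAA hb x k hw hk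
    · refine (Submodule.ne_bot_iff _).2 ⟨a, ⟨ha, ?_⟩, ha0⟩
      exact (Module.End.mem_maxGenEigenspace _ _ _).2 ⟨1, by simpa using hba⟩
  rw [← key] at hc
  obtain ⟨k, hk⟩ := (Module.End.mem_maxGenEigenspace _ _ _).1 hc.2
  exact ⟨k, by simpa using hk⟩

/-- If all elements of `I` act nilpotently on `A`, and they commute modulo `A`, then they have a
common nonzero null vector in `A`. -/
theorem exists_ne_zero_forall_mul_eq_zero [SMulCommClass F L L] [IsLeftLeibniz L]
    [FiniteDimensional F A.toSubmodule]
    (hA0 : A.toSubmodule ≠ ⊥)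
    (hAA : ∀ a ∈ A.toSubmodule, ∀ a' ∈ A.toSubmodule, a * a' = 0) {I : Set L}
    (hI : ∀ b ∈ I, ∀ c ∈ I, b * c ∈ A.toSubmodule)
    (hnil : ∀ b ∈ I, ∀ a ∈ A.toSubmodule, ∃ k, (LinearMap.mulLeft F b ^ k) a = 0) :
    ∃ w ∈ A.toSubmodule, w ≠ 0 ∧ ∀ b ∈ I, b * w = 0 := by
  -- In a nonzero `I`-stable subspace of least dimension, the kernel of each `b ∈ I` is nonzero and
  -- again `I`-stable, so it is everything.
  obtain ⟨W, ⟨hWA, hW0, hW⟩, hWmin⟩ := exists_minimalFor_of_wellFoundedLT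
    (fun W : Submodule F L => W ≤ A.toSubmodule ∧ W ≠ ⊥ ∧ ∀ b ∈ I, ∀ w ∈ W, b * w ∈ W)
    (fun W => Module.finrank F W) ⟨A.toSubmodule, le_rfl, hA0, fun b _ w hw =>
      A.mul_mem_left' b w hw⟩
  have : FiniteDimensional F W := Submodule.finiteDimensional_of_le hWA
  obtain ⟨w, hw, hw0⟩ := (Submodule.ne_bot_iff _).1 hW0
  refine ⟨w, hWA hw, hw0, fun b hb => ?_⟩
  have hle : W ⊓ LinearMap.ker (LinearMap.mulLeft F b) ≤ W := inf_le_left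
  have hne : W ⊓ LinearMap.ker (LinearMap.mulLeft F b) ≠ ⊥ := by
    have hmem : ∀ k, (LinearMap.mulLeft F b ^ k) w ∈ W := fun k => by
      induction k with
      | zero => exact hw
      | succ k ih => rw [pow_succ', Module.End.mul_apply]; exact hW b hb _ ih
    classical
    have hex := hnil b hb w (hWA hw)
    have hpos : Nat.find hex ≠ 0 := fun h => hw0 (by simpa [h] using Nat.find_spec hex)
    obtain ⟨k, hk⟩ := Nat.exists_eq_succ_of_ne_zero hpos
    refine (Submodule.ne_bot_iff _).2 ⟨(LinearMap.mulLeft F b ^ k) w, ⟨hmem k, ?_⟩,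
      Nat.find_min hex (by omega)⟩
    have := Nat.find_spec hex
    rw [hk, Nat.succ_eq_add_one, pow_succ', Module.End.mul_apply] at this
    exact this
  have heq : W ⊓ LinearMap.ker (LinearMap.mulLeft F b) = W := by
    refine Submodule.eq_of_le_of_finrank_le hle (hWmin ⟨hle.trans hWA, hne, ?_⟩
      (Submodule.finrank_mono hle))
    rintro c hc v ⟨hv, hbv⟩
    have hbv : b * v = 0 := hbv
    refine ⟨hW c hc v hv, ?_⟩
    change b * (c * v) = 0
    rw [IsLeftLeibniz.leibniz, hbv, mul_zero, add_zero, hAA _ (hI b hb c hc) _ (hWA hv)]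
  exact (heq.ge hw).2

/-- In a solvable left Leibniz algebra, if a proper finite-dimensional minimal ideal `A` is its own
right centralizer, then some element acts injectively on `A` with its square mapping `L`
into `A`. -/
theorem IsMinimal.exists_injective_mulLeft [IsScalarTower F L L] [SMulCommClass F L L] [IsLeftLeibniz L]
    (hL : Solvable F L)
    [FiniteDimensional F A.toSubmodule] (hmin : A.IsMinimal)
    (hcent : rightCentralizer (A.toSubmodule : Set L) = (A.toSubmodule : Set L))
    (hA : A.toSubmodule ≠ ⊤) :
    ∃ b : L, (∀ x, b * (b * x) ∈ A.toSubmodule) ∧ ∀ a ∈ A.toSubmodule, b * a = 0 → a = 0 := by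
  have hsymm : ∀ a ∈ A.toSubmodule, ∀ x : L, a * x = -(x * a) :=
    fun a ha x => hmin.mul_eq_neg_mul hcent.le hA ha x
  have hAA : ∀ a ∈ A.toSubmodule, ∀ a' ∈ A.toSubmodule, a * a' = 0 :=
    fun a ha a' ha' => hcent.ge ha' a ha
  obtain ⟨n, hn, hn'⟩ := hL.exists_derivedSeries_succ_le hA
  have hI : ∀ b ∈ derivedSeries F L n, ∀ c ∈ derivedSeries F L n, b * c ∈ A.toSubmodule :=
    fun b hb c hc => hn' (mul_mem_derivedSeries_succ hb hc)
  have hI2 : ∀ b ∈ derivedSeries F L n, ∀ x, b * (b * x) ∈ A.toSubmodule :=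
    fun b hb x => hI b hb _ (mul_mem_derivedSeries_right n x hb)
  by_contra! hcon
  obtain ⟨w, hw, hw0, hIw⟩ := exists_ne_zero_forall_mul_eq_zero hmin.1 hAA
    (I := derivedSeries F L n) hI fun b hb c hc => by
      obtain ⟨a, ha, hba, ha0⟩ := hcon b (hI2 b hb)
      exact hmin.exists_pow_mulLeft_eq_zero hsymm hAA (hI2 b hb) ha ha0 hba hc
  -- The common null space is stable under `L` because `b * x` stays in the derived term.
  let Z : Submodule F L := A.toSubmodule ⊓
    ⨅ b : derivedSeries F L n, LinearMap.ker (LinearMap.mulLeft F (b : L))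
  have hZ : ∀ a, a ∈ Z ↔ a ∈ A.toSubmodule ∧ ∀ b ∈ derivedSeries F L n, b * a = 0 := fun a => by
    simp [Z, Submodule.mem_iInf]
  have hZA : Z = A.toSubmodule := by
    refine hmin.eq_of_mul_mem hsymm inf_le_left (fun x z hz => ?_)
      ((Submodule.ne_bot_iff _).2 ⟨w, (hZ w).2 ⟨hw, hIw⟩, hw0⟩)
    obtain ⟨hz, hIz⟩ := (hZ z).1 hz
    refine (hZ _).2 ⟨A.mul_mem_left' x z hz, fun b hb => ?_⟩
    rw [IsLeftLeibniz.leibniz, hIz b hb, hIz _ (mul_mem_derivedSeries_right n x hb), mul_zero,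
      add_zero]
  refine hn fun b hb => hcent.le fun a ha => ?_
  rw [hsymm a ha, ((hZ a).1 (hZA ▸ ha)).2 b hb, neg_zero]

/-- Injectivity of left multiplication by `b` on a finite-dimensional ideal gives surjectivity. -/
theorem exists_mul_eq [SMulCommClass F L L]
    [FiniteDimensional F A.toSubmodule] {b : L}
    (hinj : ∀ a ∈ A.toSubmodule, b * a = 0 → a = 0) {c : L} (hc : c ∈ A.toSubmodule) :
    ∃ a ∈ A.toSubmodule, b * a = c := by
  let f : A.toSubmodule →ₗ[F] A.toSubmodule :=
    (LinearMap.mulLeft F b).restrict fun a ha => A.mul_mem_left' b a ha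
  have hf : Function.Injective f := (injective_iff_map_eq_zero f).2 fun a ha =>
    Subtype.ext (hinj a a.2 (congrArg Subtype.val ha))
  obtain ⟨a, ha⟩ := LinearMap.surjective_of_injective hf ⟨c, hc⟩
  exact ⟨a, a.2, congrArg Subtype.val ha⟩

end AlgIdeal

/-! ### Splitting of extensions. -/

namespace Extension

variable {F : Type*} [Field F]

theorem splits_of_existsUnique {N E Q : Type*}
    [NonUnitalNonAssocRing N] [Module F N] [NonUnitalNonAssocRing E] [Module F E]
    [NonUnitalNonAssocRing Q] [Module F Q] (X : Extension F N E Q) (K : NonUnitalSubalgebra F E)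
    (hK : ∀ q : Q, ∃ k ∈ K, X.proj k = q) (hK0 : ∀ k ∈ K, X.proj k = 0 → k = 0) :
    X.Splits := by
  choose s hs hps using hK
  have uniq : ∀ {k q}, k ∈ K → X.proj k = q → s q = k := fun {k q} hk h => sub_eq_zero.1
    (hK0 _ (sub_mem (hs q) hk) (by rw [map_sub, hps, h, sub_self]))
  exact ⟨{ toFun := s
           map_smul' := fun c q => uniq (K.toSubmodule.smul_mem c (hs q)) (by simp [hps])
           map_zero' := uniq (zero_mem K) (map_zero _)
           map_add' := fun q r => uniq (add_mem (hs q) (hs r)) (by simp [hps])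
           map_mul' := fun q r => uniq (mul_mem (hs q) (hs r)) (by simp [hps]) }, hps⟩

theorem splits_of_injective_mulLeft {L E : Type*} [NonUnitalNonAssocRing L] [Module F L]
    [IsScalarTower F L L] [SMulCommClass F L L] [IsLeftLeibniz L]
    [NonUnitalNonAssocRing E] [Module F E]
    [IsScalarTower F E E] [SMulCommClass F E E] [IsLeftLeibniz E]
    {A : AlgIdeal F L} [FiniteDimensional F A.toSubmodule]
    (X : Extension F A.toSubalgebra E A.Quotient) (hX : X.InducesNaturalActions) {b : L}
    (hb : ∀ x, b * (b * x) ∈ A.toSubmodule) (hinj : ∀ a ∈ A.toSubmodule, b * a = 0 → a = 0) :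
    X.Splits := by
  obtain ⟨e, he⟩ := X.proj_surjective (A.mkQ b)
  have hmul : ∀ a : A.toSubalgebra, e * X.incl a = X.incl ⟨b * a, A.mul_mem_left' b a a.2⟩ :=
    fun a => (hX e b he a).1
  have hS : ∀ x, e * (e * x) ∈ Set.range X.incl := fun x => by
    refine (X.exact _).1 ?_
    obtain ⟨y, hy⟩ := A.mkQ_surjective (X.proj x)
    rw [map_mul, map_mul, he, ← hy, ← A.mkQ_mul, ← A.mkQ_mul, ← map_zero A.mkQ, A.mkQ_eq_iff,
      sub_zero]
    exact hb y
  have hSinj : ∀ a ∈ Set.range X.incl, e * a = 0 → a = 0 := by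
    rintro _ ⟨a, rfl⟩ h
    rw [hmul, map_eq_zero_iff _ X.incl_injective] at h
    rw [show a = 0 from Subtype.ext (hinj a a.2 (congrArg Subtype.val h)), map_zero]
  let K : NonUnitalSubalgebra F E :=
    { LinearMap.ker (LinearMap.mulLeft F e ∘ₗ LinearMap.mulLeft F e) with
      mul_mem' := fun hx hy => mul_mul_mul_eq_zero hS hSinj hx hy }
  refine X.splits_of_existsUnique K (fun q => ?_) fun k hk h => ?_
  · obtain ⟨x, rfl⟩ := X.proj_surjective q
    obtain ⟨c, hc⟩ := hS x
    -- Dividing `e * (e * x)` twice by `b` inside `A` gives the correction that moves `x` into `K`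
    -- without changing its class.
    obtain ⟨a', ha', hbc⟩ := AlgIdeal.exists_mul_eq hinj c.2
    obtain ⟨a, ha, hba⟩ := AlgIdeal.exists_mul_eq hinj ha'
    refine ⟨x - X.incl ⟨a, ha⟩, ?_, ?_⟩
    · change e * (e * (x - X.incl ⟨a, ha⟩)) = 0
      rw [mul_sub, mul_sub, hmul, hmul, ← hc, sub_eq_zero]
      exact congrArg X.incl (Subtype.ext (by simp only [hba, hbc]))
    · rw [map_sub, (X.exact _).2 ⟨_, rfl⟩, sub_zero]
  · have hk' := (X.exact _).1 h
    have hek : e * k ∈ Set.range X.incl := by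
      obtain ⟨a, rfl⟩ := hk'
      exact ⟨_, (hmul a).symm⟩
    exact hSinj _ hk' (hSinj _ hek hk)

end Extension

/-! ### Conjugacy of complements. -/

namespace AlgIdeal

variable {F : Type*} [Field F] {L : Type*} [NonUnitalNonAssocRing L] [Module F L]
  {A : AlgIdeal F L}

variable (A) in
/-- The automorphism `id + L_a` of `L`, for `a` in an ideal `A` with zero product. -/
def expHom [SMulCommClass F L L] [IsLeftLeibniz L]
    (hAA : ∀ a ∈ A.toSubmodule, ∀ a' ∈ A.toSubmodule, a * a' = 0) (a : L)
    (ha : a ∈ A.toSubmodule) : L →ₙₐ[F] L where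
  toFun x := x + a * x
  map_smul' c x := by simp [mul_smul_comm]
  map_zero' := by simp
  map_add' x y := by rw [mul_add]; abel
  -- The only term beyond the derivation rule is `(a * x) * (a * y)`, which lies in `A * A = 0`.
  map_mul' x y := by
    rw [IsLeftLeibniz.leibniz a x y, add_mul, mul_add, mul_add,
      hAA _ (A.mul_mem_right' a x ha) _ (A.mul_mem_right' a y ha)]
    abel

theorem expHom_bijective [SMulCommClass F L L] [IsLeftLeibniz L]
    (hAA : ∀ a ∈ A.toSubmodule, ∀ a' ∈ A.toSubmodule, a * a' = 0) {a : L}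
    (ha : a ∈ A.toSubmodule) : Function.Bijective (A.expHom hAA a ha) := by
  have h : ∀ x, a * (a * x) = 0 := fun x => hAA a ha _ (A.mul_mem_right' a x ha)
  refine Function.bijective_iff_has_inverse.2 ⟨fun x => x - a * x, fun x => ?_, fun x => ?_⟩
  · change x + a * x - a * (x + a * x) = x
    rw [mul_add, h]; abel
  · change x - a * x + a * (x - a * x) = x
    rw [mul_sub, h]; abel

/-- A complement of `A` is the null space of the square of left multiplication by any of its
elements that acts injectively on `A` and squares into `A`. -/
theorem IsComplement.mem_iff {K : NonUnitalSubalgebra F L} (hK : A.IsComplement K) {k : L}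
    (hk : k ∈ K) (hk2 : ∀ x, k * (k * x) ∈ A.toSubmodule)
    (hinj : ∀ a ∈ A.toSubmodule, k * a = 0 → a = 0) (x : L) : x ∈ K ↔ k * (k * x) = 0 := by
  have hK2 : ∀ y ∈ K, k * (k * y) = 0 := fun y hy =>
    (Submodule.disjoint_def.1 hK.disjoint) _ (hk2 y) (K.mul_mem hk (K.mul_mem hk hy))
  refine ⟨hK2 x, fun h => ?_⟩
  obtain ⟨a, ha, y, hy, rfl⟩ :=
    Submodule.mem_sup.1 (hK.sup_eq_top.ge (Submodule.mem_top : x ∈ _))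
  have hy' : y ∈ K := hy
  rw [mul_add, mul_add, hK2 y hy', add_zero] at h
  have ha0 := hinj _ ha (hinj _ (A.mul_mem_left' k a ha) h)
  rwa [ha0, zero_add]

theorem IsComplement.exists_sub_mem {K : NonUnitalSubalgebra F L} (hK : A.IsComplement K) (b : L) :
    ∃ k ∈ K, k - b ∈ A.toSubmodule := by
  obtain ⟨a, ha, y, hy, rfl⟩ :=
    Submodule.mem_sup.1 (hK.sup_eq_top.ge (Submodule.mem_top : b ∈ _))
  exact ⟨y, hy, by simpa using A.toSubmodule.neg_mem ha⟩

theorem mul_mul_mem_of_sub_mem {b k : L} (hb : ∀ x, b * (b * x) ∈ A.toSubmodule)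
    (hkb : k - b ∈ A.toSubmodule) (x : L) : k * (k * x) ∈ A.toSubmodule := by
  have h : k * (k * x) = (k - b) * (k * x) + b * ((k - b) * x) + b * (b * x) := by
    simp only [sub_mul, mul_sub]; abel
  rw [h]
  exact add_mem (add_mem (A.mul_mem_right' _ _ hkb)
    (A.mul_mem_left' _ _ (A.mul_mem_right' _ _ hkb))) (hb x)

theorem mul_eq_mul_of_sub_mem (hAA : ∀ a ∈ A.toSubmodule, ∀ a' ∈ A.toSubmodule, a * a' = 0)
    {b k : L} (hkb : k - b ∈ A.toSubmodule) {a : L} (ha : a ∈ A.toSubmodule) : k * a = b * a := by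
  rw [← sub_eq_zero, ← sub_mul, hAA _ hkb _ ha]

/-- An automorphism taking `k` to `k'` takes `ker (L_k ^ 2)` to `ker (L_k' ^ 2)`, and these are `K`
and `K'`. -/
theorem exists_expHom_map_eq [SMulCommClass F L L] [IsLeftLeibniz L]
    [FiniteDimensional F A.toSubmodule]
    (hAA : ∀ a ∈ A.toSubmodule, ∀ a' ∈ A.toSubmodule, a * a' = 0)
    (hsymm : ∀ a ∈ A.toSubmodule, ∀ x : L, a * x = -(x * a)) {b : L}
    (hb : ∀ x, b * (b * x) ∈ A.toSubmodule) (hinj : ∀ a ∈ A.toSubmodule, b * a = 0 → a = 0)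
    {K K' : NonUnitalSubalgebra F L} (hK : A.IsComplement K) (hK' : A.IsComplement K') :
    ∃ (a : L) (ha : a ∈ A.toSubmodule), K.map (A.expHom hAA a ha) = K' := by
  obtain ⟨k, hk, hkb⟩ := hK.exists_sub_mem b
  obtain ⟨k', hk', hkb'⟩ := hK'.exists_sub_mem b
  have hkk : k - k' ∈ A.toSubmodule := by simpa using sub_mem hkb hkb'
  obtain ⟨a, ha, hba⟩ := exists_mul_eq hinj hkk
  refine ⟨a, ha, ?_⟩
  -- By symmetry `a * k = -(k * a) = -(b * a) = k' - k`.
  have hσ : A.expHom hAA a ha k = k' := by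
    change k + a * k = k'
    rw [hsymm a ha, mul_eq_mul_of_sub_mem hAA hkb ha, hba]; abel
  have hmem := hK.mem_iff hk (mul_mul_mem_of_sub_mem hb hkb) fun c hc h =>
    hinj c hc (by rwa [mul_eq_mul_of_sub_mem hAA hkb hc] at h)
  have hmem' := hK'.mem_iff hk' (mul_mul_mem_of_sub_mem hb hkb') fun c hc h =>
    hinj c hc (by rwa [mul_eq_mul_of_sub_mem hAA hkb' hc] at h)
  have hσmem : ∀ x, A.expHom hAA a ha x ∈ K' ↔ x ∈ K := fun x => by
    rw [hmem, hmem', ← hσ, ← map_mul, ← map_mul,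
      map_eq_zero_iff _ (expHom_bijective hAA ha).injective]
  ext y
  obtain ⟨x, rfl⟩ := (expHom_bijective hAA ha).surjective y
  rw [hσmem, NonUnitalSubalgebra.mem_map]
  exact ⟨fun ⟨z, hz, h⟩ => (expHom_bijective hAA ha).injective h ▸ hz, fun hx => ⟨x, hx, rfl⟩⟩

end AlgIdeal

end LeibnizAlg

theorem theorem5p4 {F : Type*} [Field F]
    {L : Type*} [NonUnitalNonAssocRing L] [Module F L]
    [IsScalarTower F L L] [SMulCommClass F L L] [LeibnizAlg.IsLeftLeibniz L]
    (hL : LeibnizAlg.Solvable F L)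
    (A : LeibnizAlg.AlgIdeal F L) (hfin : FiniteDimensional F A.toSubmodule)
    (hmin : A.IsMinimal)
    (hcent : LeibnizAlg.rightCentralizer (A.toSubmodule : Set L) = (A.toSubmodule : Set L)) :
    (∀ (E : Type*) [NonUnitalNonAssocRing E] [Module F E]
        [IsScalarTower F E E] [SMulCommClass F E E] [LeibnizAlg.IsLeftLeibniz E]
        (X : LeibnizAlg.Extension F A.toSubalgebra E A.Quotient),
        X.InducesNaturalActions → X.Splits) ∧
    (∀ K K' : NonUnitalSubalgebra F L, A.IsComplement K → A.IsComplement K' →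
        ∃ a ∈ A.toSubmodule, (∀ x : L, a * (a * x) = 0) ∧
          ∃ σ : L →ₙₐ[F] L, (∀ x : L, σ x = x + a * x) ∧ Function.Bijective σ ∧
            K.map σ = K') := by
  have hAA : ∀ a ∈ A.toSubmodule, ∀ a' ∈ A.toSubmodule, a * a' = 0 :=
    fun a ha a' ha' => hcent.ge ha' a ha
  -- If `A = L`, all products vanish and no `b` exists, but then `L / A = 0` and the only complement
  -- is `0`.
  by_cases hA : A.toSubmodule = ⊤
  · refine ⟨fun E _ _ _ _ _ X _ => ⟨0, fun q => ?_⟩, fun K K' hK hK' => ?_⟩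
    · obtain ⟨x, rfl⟩ := A.mkQ_surjective q
      rw [NonUnitalAlgHom.zero_apply, map_zero, ← map_zero A.mkQ, A.mkQ_eq_iff, hA]
      exact Submodule.mem_top
    · have h0 : ∀ H : NonUnitalSubalgebra F L, A.IsComplement H → H.toSubmodule = ⊥ := fun H hH =>
        eq_bot_of_top_isCompl (hA ▸ hH)
      have hKK : K = K' := NonUnitalSubalgebra.toSubmodule_injective
        ((h0 K hK).trans (h0 K' hK').symm)
      exact ⟨0, zero_mem _, by simp, NonUnitalAlgHom.id F L, by simp, Function.bijective_id,
        by rw [NonUnitalSubalgebra.map_id, hKK]⟩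
  · obtain ⟨b, hb, hinj⟩ := hmin.exists_injective_mulLeft hL hcent hA
    refine ⟨fun E _ _ _ _ _ X hX => X.splits_of_injective_mulLeft hX hb hinj,
      fun K K' hK hK' => ?_⟩
    obtain ⟨a, ha, h⟩ := LeibnizAlg.AlgIdeal.exists_expHom_map_eq hAA
      (fun a ha x => hmin.mul_eq_neg_mul hcent.le hA ha x) hb hinj hK hK'
    exact ⟨a, ha, fun x => hAA a ha _ (A.mul_mem_right' a x ha), A.expHom hAA a ha,
      fun x => rfl, LeibnizAlg.AlgIdeal.expHom_bijective hAA ha, h⟩
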